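/- Let $N\ge 3$ and $d\ge 2$, and let $|\psi\rangle$ be a Haar-random pure state, i.e. uniformly distributed on the unit sphere of $(\mathbb{C}^d)^{\otimes N}$. For a set $S\subseteq\{1,\dots,N\}$ of qudits and a state $\eta$ on $(\mathbb{C}^d)^{\otimes N}$, let $\eta_S=\operatorname{tr}_{S^c}\eta$ be its marginal on $S$; write $\psi_S$ for the marginal of $|\psi\rangle\langle\psi|$. A state of the qudits in $R$ is *entangled across all cuts* if for every partition $R=A\sqcup B$ into nonempty sets it is not a finite convex combination of tensor products of density matrices on $A$ and on $B$. Say that $k$ is *large* if $k\ge \frac N2+1$ when $d=2$, and if $k>\frac N2$ when $d\ge 3$. For a family $\mathcal G$ of subsets of $\{1,\dots,N\}$, say that the (automatically compatible) marginals $(\psi_S)_{S\in\mathcal G}$ *exhibit entanglement transitivity* if (a) $\psi_S$ is entangled across all cuts for every $S\in\mathcal G$, and (b) for every state $\eta$, pure or mixed, on $(\mathbb{C}^d)^{\otimes N}$ with $\eta_S=\psi_S$ for all $S\in\mathcal G$, and every $R\subseteq\{1,\dots,N\}$ with $R\notin\mathcal G$ and $|R|$ large, the marginal $\eta_R$ is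 entangled across all cuts. 1. Suppose that $d\ge 3$ or $N$ is even. Let $S,T$ be any two sets of $\lfloor\frac N2\rfloor+1$ qudits with $|S\cap T|=2$ if $N$ is even and $|S\cap T|=1$ if $N$ is odd. Then, almost surely, the two marginals $\psi_S,\psi_T$ exhibit entanglement transitivity. 2. Let $K$ be any set of $\lceil\frac N2\rceil$ qudits. Then, almost surely, the $\lfloor\frac N2\rfloor$ marginals $\psi_{K\cup\{j\}}$, $j\notin K$, each on $\lceil\frac N2\rceil+1$ qudits, exhibit entanglement transitivity. -/

import Mathlib

open MeasureTheory Finset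
open scoped Kronecker ComplexOrder

noncomputable section

/-- A density matrix (quantum state, pure or mixed) on the Hilbert space with basis `I`. -/
def IsDensityMatrix {I : Type*} [Fintype I] (ρ : Matrix I I ℂ) : Prop :=
  ρ.PosSemidef ∧ ρ.trace = 1

/-- Separability of a bipartite matrix on `ℂ^I ⊗ ℂ^J`: a finite convex combination of tensor
products of density matrices. -/
def IsSeparableState {I J : Type*} [Fintype I] [Fintype J] (ρ : Matrix (I × J) (I × J) ℂ) : Prop :=
  ∃ (n : ℕ) (p : Fin n → ℝ) (σ : Fin n → Matrix I I ℂ) (τ : Fin n → Matrix J J ℂ),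
    (∀ i, 0 ≤ p i) ∧ ∑ i, p i = 1 ∧
    (∀ i, IsDensityMatrix (σ i)) ∧ (∀ i, IsDensityMatrix (τ i)) ∧
    ρ = ∑ i, (p i : ℂ) • (σ i ⊗ₖ τ i)

/-- The basis of `(ℂ^d)^{⊗ ι}` is `ι → Fin d`. For a set `S` of parties, this is the
identification of this basis with the one of `(ℂ^d)^{⊗ S} ⊗ (ℂ^d)^{⊗ Sᶜ}`. -/
def splitEquiv {ι : Type*} [DecidableEq ι] (d : ℕ) (S : Finset ι) :
    (ι → Fin d) ≃ ({i // i ∈ S} → Fin d) × ({i // i ∉ S} → Fin d) :=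
  Equiv.piEquivPiSubtypeProd (fun i => i ∈ S) (fun _ => Fin d)

/-- The marginal on the parties in `S`: the partial trace over the parties outside `S`. -/
def marginal {ι : Type*} [Fintype ι] [DecidableEq ι] {d : ℕ} (S : Finset ι)
    (ρ : Matrix (ι → Fin d) (ι → Fin d) ℂ) :
    Matrix ({i // i ∈ S} → Fin d) ({i // i ∈ S} → Fin d) ℂ :=
  fun x y => ∑ z : {i // i ∉ S} → Fin d,
    ρ ((splitEquiv d S).symm (x, z)) ((splitEquiv d S).symm (y, z))

/-- The state `ρ` of the parties `ι` is entangled (i.e. not separable) across the cut `A | Aᶜ`. -/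
def EntangledAcross {ι : Type*} [Fintype ι] [DecidableEq ι] {d : ℕ}
    (ρ : Matrix (ι → Fin d) (ι → Fin d) ℂ) (A : Finset ι) : Prop :=
  ¬ IsSeparableState (Matrix.reindex (splitEquiv d A) (splitEquiv d A) ρ)

/-- Entanglement across every bipartition of the parties `ι` into two nonempty groups. -/
def EntangledAcrossAllCuts {ι : Type*} [Fintype ι] [DecidableEq ι] {d : ℕ}
    (ρ : Matrix (ι → Fin d) (ι → Fin d) ℂ) : Prop :=
  ∀ A : Finset ι, A.Nonempty → A ≠ Finset.univ → EntangledAcross ρ A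

/-- The global state `η` (pure or mixed) has, for every `S` in the family `G`, the prescribed
marginal `σ S`. -/
def IsCompatible {N d : ℕ} (G : Finset (Finset (Fin N)))
    (σ : (S : Finset (Fin N)) → Matrix ({i // i ∈ S} → Fin d) ({i // i ∈ S} → Fin d) ℂ)
    (η : Matrix (Fin N → Fin d) (Fin N → Fin d) ℂ) : Prop :=
  IsDensityMatrix η ∧ ∀ S ∈ G, marginal S η = σ S

/-- The given states `σ S`, `S ∈ G`, exhibit entanglement transitivity in the target sets `T`:
they are compatible, each is entangled across all cuts, and every global state compatible with
them has, on every target set, a marginal which is entangled across all cuts. -/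
structure ExhibitsTransitivity {N d : ℕ} (G : Finset (Finset (Fin N)))
    (σ : (S : Finset (Fin N)) → Matrix ({i // i ∈ S} → Fin d) ({i // i ∈ S} → Fin d) ℂ)
    (T : Set (Finset (Fin N))) : Prop where
  compatible : ∃ η, IsCompatible G σ η
  given_entangled : ∀ S ∈ G, EntangledAcrossAllCuts (σ S)
  forced_entangled : ∀ η, IsCompatible G σ η → ∀ R ∈ T, EntangledAcrossAllCuts (marginal R η)

/-- The size threshold for entanglement across all cuts: `k ≥ N / 2 + 1` for qubits (where a cut
splitting off one qubit always occurs), and `k > N / 2` for `d ≥ 3`. -/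
def SizeThreshold (d N k : ℕ) : Prop :=
  if d = 2 then N + 2 ≤ 2 * k else N < 2 * k

/-- The remaining sets of parties, i.e. those not in `G`, whose size satisfies the threshold. -/
def remainingLarge (d : ℕ) {N : ℕ} (G : Finset (Finset (Fin N))) : Set (Finset (Fin N)) :=
  {R | R ∉ G ∧ SizeThreshold d N R.card}

/-- The Hilbert space `(ℂ^d)^{⊗ N}` of `N` qudits, in the product basis. -/
abbrev QuditSpace (N d : ℕ) : Type := EuclideanSpace ℂ (Fin N → Fin d)

/-- The uniform (Haar) probability measure on the unit sphere of `(ℂ^d)^{⊗ N}`: the normalized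
surface measure. -/
def haarPureState (N d : ℕ) : Measure (Metric.sphere (0 : QuditSpace N d) 1) :=
  ((volume : Measure (QuditSpace N d)).toSphere Set.univ)⁻¹ •
    (volume : Measure (QuditSpace N d)).toSphere

/-- The density matrix `|ψ⟩⟨ψ|`. -/
def pureDensity {N d : ℕ} (ψ : QuditSpace N d) : Matrix (Fin N → Fin d) (Fin N → Fin d) ℂ :=
  Matrix.of fun x y => ψ x * star (ψ y)

end

/-!
A compatible state `η` is a Gram matrix `Φ * Φᴴ`, and equality of marginals on `S` says that every
column of `Φ` is obtained from `ψ` by an operator acting outside `S` only. Almost surely, a vector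
which is obtained from `ψ` in this way for every `S` in the family is a multiple of `ψ`, so that
`η = |ψ⟩⟨ψ|`:

* If all `S` contain a set `K` of at least half of the parties, then the coefficient matrix of `ψ`
  has independent columns, and an operator acting outside `K` is determined by its value at `ψ`. The
  same operator thus acts outside every `S`, that is, as a scalar.
* For two sets covering all parties, which may be taken of equal size, the coefficients of `ψ`,
  sorted by their indices on `S ∩ T`, form at least three generic square matrices `A b`, and
  matrices `V`, `W` with `A b * V = W * A b` for all `b` are scalar.

The marginals of `ψ` are entangled by the range criterion: the range of a separable state contains
a nonzero product vector, but a generic subspace of dimension at most `(m - 1) * (n - 1)` of an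
`m * n`-dimensional tensor product does not.
-/

section AlmostEverywhere

variable {E : Type*} [NormedAddCommGroup E] [NormedSpace ℝ E] [FiniteDimensional ℝ E]
  [MeasurableSpace E] [BorelSpace E] (μ : Measure E) [μ.IsAddHaarMeasure]

theorem addHaar_range_eq_zero_of_finrank_lt {F : Type*} [NormedAddCommGroup F] [NormedSpace ℝ F]
    [FiniteDimensional ℝ F] {f : F → E} (hf : ContDiff ℝ 1 f)
    (h : Module.finrank ℝ F < Module.finrank ℝ E) : μ (Set.range f) = 0 := by
  have hdim : dimH (Set.range f) < ((Module.finrank ℝ E : NNReal) : ENNReal) :=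
    hf.dimH_range_le.trans_lt (mod_cast h)
  have hnull := hausdorffMeasure_of_dimH_lt hdim
  rw [NNReal.coe_natCast] at hnull
  exact Measure.absolutelyContinuous_isAddHaarMeasure μ (Measure.hausdorffMeasure _) hnull

theorem finite_setOf_det_add_smul_eq_zero {n : Type*} [Fintype n] [DecidableEq n]
    (A : Matrix n n ℂ) {B : Matrix n n ℂ} (hB : B.det ≠ 0) :
    {t : ℝ | (A + (t : ℂ) • B).det = 0}.Finite := by
  let q : Polynomial ℂ :=
    ((Polynomial.X : Polynomial ℂ) • B.map Polynomial.C + A.map Polynomial.C).det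
  have hcoeff : q.coeff (Fintype.card n) = B.det := Polynomial.coeff_det_X_add_C_card B A
  have hq : q ≠ 0 := fun h => hB (by rw [← hcoeff, h, Polynomial.coeff_zero])
  refine ((Polynomial.finite_setOfPred_isRoot hq).preimage
    Complex.ofReal_injective.injOn).subset fun t ht => ?_
  have heval : (Polynomial.evalRingHom (t : ℂ)).mapMatrix
      ((Polynomial.X : Polynomial ℂ) • B.map Polynomial.C + A.map Polynomial.C)
        = A + (t : ℂ) • B := by
    ext i j
    simp [add_comm (A i j), mul_comm (t : ℂ)]
  change Polynomial.evalRingHom (t : ℂ) q = 0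
  rw [RingHom.map_det, heval]
  exact ht

theorem ae_det_ne_zero_of_linear_family {n : Type*} [Fintype n] [DecidableEq n]
    (L : E →ₗ[ℝ] Matrix n n ℂ) {p₀ : E} (h₀ : (L p₀).det ≠ 0) : ∀ᵐ p ∂μ, (L p).det ≠ 0 := by
  have hcont : Continuous fun p => (L p).det :=
    L.continuous_of_finiteDimensional.matrix_det
  refine ae_mem_of_ae_add_linearMap_mem (LinearMap.toSpanSingleton ℝ E p₀) volume μ
    (isOpen_ne_fun hcont continuous_const).measurableSet fun y => ?_
  refine ((finite_setOf_det_add_smul_eq_zero (L y) h₀).countable.ae_notMem volume).mono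
    fun t ht => ?_
  change (L (y + LinearMap.toSpanSingleton ℝ E p₀ t)).det ≠ 0
  simpa using ht

theorem ae_injective_of_linear_family {V W : Type*} [AddCommGroup V] [Module ℂ V]
    [FiniteDimensional ℂ V] [AddCommGroup W] [Module ℂ W] (L : E →ₗ[ℝ] V →ₗ[ℂ] W) {p₀ : E}
    (h₀ : Function.Injective (L p₀)) : ∀ᵐ p ∂μ, Function.Injective (L p) := by
  obtain ⟨g, hg⟩ := (L p₀).exists_leftInverse_of_injective (LinearMap.ker_eq_bot.2 h₀)
  let b := Module.finBasis ℂ V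
  let M : E →ₗ[ℝ] Matrix _ _ ℂ := (LinearMap.toMatrix b b).toLinearMap.restrictScalars ℝ ∘ₗ
    (g.compRight ℂ (M := V)).restrictScalars ℝ ∘ₗ L
  have hM₀ : (M p₀).det ≠ 0 := by
    simp [M, hg]
  refine (ae_det_ne_zero_of_linear_family μ M hM₀).mono fun p hp => ?_
  have hdet : LinearMap.det (g ∘ₗ L p) ≠ 0 := by rwa [← LinearMap.det_toMatrix b]
  have hker : (g ∘ₗ L p).ker = ⊥ :=
    not_not.1 fun h => hdet (LinearMap.det_eq_zero_iff_ker_ne_bot.2 h)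
  exact Function.Injective.of_comp (LinearMap.ker_eq_bot.1 hker)

theorem ae_toSphere_of_ae {P : E → Prop} (hP : ∀ᵐ x ∂μ, P x)
    (hscale : ∀ x, ∀ r : ℝ, 0 < r → P (r • x) → P x) : ∀ᵐ x ∂μ.toSphere, P x.1 := by
  let B : Set (Metric.sphere (0 : E) 1) := {x | ¬ P x.1}
  have hcone : (μ.comap Subtype.val) (homeomorphUnitSphereProd E ⁻¹' (B ×ˢ Set.univ)) = 0 := by
    rw [(MeasurableEmbedding.subtype_coe (measurableSet_singleton (0 : E)).compl).comap_apply]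
    refine measure_mono_null ?_ hP
    rintro _ ⟨x, hx, rfl⟩ hPx
    have hx0 : 0 < ‖x.1‖ := norm_pos_iff.2 x.2
    refine hx.1 (hscale _ ‖x.1‖ hx0 ?_)
    rwa [homeomorphUnitSphereProd_apply_fst_coe, smul_inv_smul₀ hx0.ne']
  rw [(Measure.measurePreserving_homeomorphUnitSphereProd μ).measure_preimage_emb
    (homeomorphUnitSphereProd E).measurableEmbedding, Measure.prod_prod] at hcone
  refine (mul_eq_zero.1 hcone).resolve_right fun h => ?_
  have hIio := measure_mono_null
    (Set.subset_univ (Set.Iio (⟨1, Set.mem_Ioi.2 one_pos⟩ : Set.Ioi (0 : ℝ)))) h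
  rw [Measure.volumeIoiPow_apply_Iio, ENNReal.ofReal_eq_zero] at hIio
  exact hIio.not_gt (by positivity)

end AlmostEverywhere

section GenericFamilies

theorem ae_linearIndependent {Z V : Type*} [Fintype Z] [NormedAddCommGroup V]
    [NormedSpace ℂ V] [FiniteDimensional ℂ V] [MeasurableSpace V] [BorelSpace V]
    (μ : Measure (Z → V)) [μ.IsAddHaarMeasure]
    (hcard : Fintype.card Z ≤ Module.finrank ℂ V) :
    ∀ᵐ v ∂μ, LinearIndependent ℂ v := by
  obtain ⟨f⟩ := Function.Embedding.nonempty_of_card_le (α := Z) (β := Fin (Module.finrank ℂ V))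
    (by rwa [Fintype.card_fin])
  have hb : LinearIndependent ℂ (Module.finBasis ℂ V ∘ f) :=
    (Module.finBasis ℂ V).linearIndependent.comp f f.injective
  have := FiniteDimensional.proper_real V
  simp only [linearIndependent_iff_injective_fintypeLinearCombination] at hb ⊢
  exact ae_injective_of_linear_family μ (Fintype.bilinearCombination ℂ ℝ) hb

/-- The product vectors `a ⊗ b` of `ℂ^I ⊗ ℂ^J`. -/
def IsProductVector {I J : Type*} (v : I × J → ℂ) : Prop :=
  ∃ (a : I → ℂ) (b : J → ℂ), v = fun w => a w.1 * b w.2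

/-- A completely entangled subspace of `ℂ^I ⊗ ℂ^J`: one without nonzero product vectors. -/
def CompletelyEntangled {I J : Type*} (U : Submodule ℂ (I × J → ℂ)) : Prop :=
  ∀ v ∈ U, IsProductVector v → v = 0

variable {I J Z : Type*} [Fintype Z] [DecidableEq I] [DecidableEq Z]

/-- The families `v : Z → ℂ^I ⊗ ℂ^J` with `∑ z, c z • v z = a ⊗ b` for some `c`, `a`, `b` such that
`c i = 1` and `a l = 1`, parametrized by `c` off `i`, `v` off `i`, `a` off `l`, and `b`. -/
def familyThroughProduct (i : Z) (l : I)
    (q : ({z // z ≠ i} → ℂ × (I × J → ℂ)) × ({x // x ≠ l} → ℂ) × (J → ℂ)) :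
    Z → I × J → ℂ := fun z w =>
  if hz : z = i then
    (if hx : w.1 = l then 1 else q.2.1 ⟨w.1, hx⟩) * q.2.2 w.2 - ∑ z', (q.1 z').1 * (q.1 z').2 w
  else (q.1 ⟨z, hz⟩).2 w

theorem mem_range_familyThroughProduct {v : Z → I × J → ℂ} {c : Z → ℂ} {a : I → ℂ} {b : J → ℂ}
    (h : ∑ z, c z • v z = fun w => a w.1 * b w.2) {i : Z} (hi : c i ≠ 0) {l : I} (hl : a l ≠ 0) :
    v ∈ Set.range (familyThroughProduct (J := J) i l) := by
  refine ⟨⟨fun z => (c z / c i, v z), fun x => a x / a l, fun y => a l * b y / c i⟩, ?_⟩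
  funext z w
  by_cases hz : z = i
  · subst hz
    have ha : (if w.1 = l then (1 : ℂ) else a w.1 / a l) = a w.1 / a l := by
      split_ifs with hx
      · rw [hx, div_self hl]
      · rfl
    have hsum : c z * v z w + ∑ z' : {z' // z' ≠ z}, c z' * v z' w = a w.1 * b w.2 := by
      rw [← Fintype.sum_eq_add_sum_subtype_ne fun z' => c z' * v z' w]
      simpa using congrFun h w
    simp only [familyThroughProduct, dite_eq_ite, if_true, ha, div_mul_eq_mul_div, ← Finset.sum_div]
    field_simp
    rw [← hsum]
    ring
  · simp only [familyThroughProduct, dif_neg hz]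

variable [Fintype I] [Fintype J]

theorem contDiff_familyThroughProduct (i : Z) (l : I) :
    ContDiff ℝ 1 (familyThroughProduct (J := J) i l) := by
  refine contDiff_pi.2 fun z => contDiff_pi.2 fun w => ?_
  unfold familyThroughProduct
  split_ifs <;> fun_prop

end GenericFamilies

theorem finrank_familyThroughProduct_parameters_lt {I J Z : Type*} [Fintype I] [Fintype J]
    [Fintype Z] (i : Z) (l : I)
    (hcard : Fintype.card Z + Fintype.card I + Fintype.card J
      ≤ Fintype.card I * Fintype.card J + 1) :
    Module.finrank ℝ
      (({z // z ≠ i} → ℂ × (I × J → ℂ)) × ({x // x ≠ l} → ℂ) × (J → ℂ))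
        < Module.finrank ℝ (Z → I × J → ℂ) := by
  classical
  obtain ⟨r, hr⟩ := Nat.exists_eq_succ_of_ne_zero (Fintype.card_pos_iff.2 ⟨i⟩).ne'
  obtain ⟨s, hs⟩ := Nat.exists_eq_succ_of_ne_zero (Fintype.card_pos_iff.2 ⟨l⟩).ne'
  simp only [Module.finrank_prod, Module.finrank_pi_fintype, Complex.finrank_real_complex,
    Finset.sum_const, Finset.card_univ, Fintype.card_prod, Fintype.card_subtype_compl,
    Fintype.card_unique, smul_eq_mul, ne_eq, hr, hs, Nat.succ_eq_add_one,
    Nat.add_sub_cancel] at hcard ⊢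
  nlinarith

theorem ae_completelyEntangled_span {I J Z : Type*} [Fintype I] [Fintype J] [Fintype Z]
    (μ : Measure (Z → I × J → ℂ)) [μ.IsAddHaarMeasure]
    (hcard : Fintype.card Z + Fintype.card I + Fintype.card J
      ≤ Fintype.card I * Fintype.card J + 1) :
    ∀ᵐ v ∂μ, CompletelyEntangled (Submodule.span ℂ (Set.range v)) := by
  classical
  have hae : ∀ᵐ v ∂μ, ∀ (i : Z) (l : I), v ∉ Set.range (familyThroughProduct (J := J) i l) :=
    ae_all_iff.2 fun i => ae_all_iff.2 fun l => measure_eq_zero_iff_ae_notMem.1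
      (addHaar_range_eq_zero_of_finrank_lt μ (contDiff_familyThroughProduct i l)
        (finrank_familyThroughProduct_parameters_lt i l hcard))
  refine hae.mono fun v hv u hu ⟨a, b, hab⟩ => ?_
  obtain ⟨c, rfl⟩ := (Submodule.mem_span_range_iff_exists_fun ℂ).1 hu
  by_contra hne
  obtain ⟨i, hi⟩ : ∃ i, c i ≠ 0 := by
    by_contra! h
    simp [h] at hne
  obtain ⟨l, hl⟩ : ∃ l, a l ≠ 0 := by
    by_contra! h
    exact hne (by rw [hab]; ext; simp [h])
  exact hv i l (mem_range_familyThroughProduct hab hi hl)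

section Intertwiners

theorem exists_eq_smul_one_of_commute {I : Type*} [Fintype I] [DecidableEq I] {v : I → ℂ}
    (hv : Function.Injective v) {V : Matrix I I ℂ} (hdiag : Commute (Matrix.diagonal v) V)
    (hones : Commute (Matrix.of fun _ _ => 1) V) : ∃ c : ℂ, V = c • 1 := by
  have hoff : ∀ x y, x ≠ y → V x y = 0 := fun x y hxy => by
    have h := congrFun (congrFun hdiag.eq x) y
    rw [Matrix.diagonal_mul, Matrix.mul_diagonal, mul_comm, ← sub_eq_zero, ← mul_sub] at h
    exact (mul_eq_zero.1 h).resolve_right (sub_ne_zero.2 (hv.ne hxy))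
  have hconst : ∀ x y, V x x = V y y := fun x y => by
    have h := congrFun (congrFun hones.eq y) x
    simp only [Matrix.mul_apply, Matrix.of_apply, one_mul, mul_one] at h
    rwa [Finset.sum_eq_single x (fun z _ hz => hoff z x hz) (by simp),
      Finset.sum_eq_single y (fun z _ hz => hoff y z hz.symm) (by simp)] at h
  rcases isEmpty_or_nonempty I with _ | ⟨⟨x⟩⟩
  · exact ⟨0, Subsingleton.elim _ _⟩
  · refine ⟨V x x, ?_⟩
    ext y z
    rcases eq_or_ne y z with rfl | hyz
    · simpa using hconst y x
    · simp [hoff y z hyz, hyz]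

variable {I B : Type*} [Fintype I] [DecidableEq I]

theorem exists_intertwiner_scalar [Fintype B] (hB : 3 ≤ Fintype.card B) :
    ∃ A : B → Matrix I I ℂ, ∀ V W : Matrix I I ℂ, (∀ b, A b * V = W * A b) →
      V = W ∧ ∃ c : ℂ, V = c • 1 := by
  classical
  obtain ⟨b₀, b₁, b₂, h01, h02, h12⟩ := Fintype.two_lt_card_iff.1 (show 2 < Fintype.card B from hB)
  let v : I → ℂ := fun x => (Fintype.equivFin I x : ℕ)
  have hv : Function.Injective v :=
    Nat.cast_injective.comp (Fin.val_injective.comp (Fintype.equivFin I).injective)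
  refine ⟨fun b => if b = b₀ then 1 else if b = b₁ then Matrix.diagonal v
    else Matrix.of fun _ _ => 1, fun V W h => ?_⟩
  have hVW : V = W := by simpa using h b₀
  subst hVW
  refine ⟨rfl, exists_eq_smul_one_of_commute hv ?_ ?_⟩
  · exact show _ = _ by simpa [h01.symm] using h b₁
  · exact show _ = _ by simpa [h02.symm, h12.symm] using h b₂

theorem exists_trace_sub_smul_one_eq_zero (V : Matrix I I ℂ) :
    ∃ c : ℂ, (V - c • 1).trace = 0 := by
  rcases isEmpty_or_nonempty I
  · exact ⟨0, by simp [Matrix.trace]⟩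
  · exact ⟨V.trace / Fintype.card I, by simp⟩

theorem smul_one_eq_zero_of_trace_eq_zero {c : ℂ} (h : (c • (1 : Matrix I I ℂ)).trace = 0) :
    c • (1 : Matrix I I ℂ) = 0 := by
  rcases isEmpty_or_nonempty I
  · exact Subsingleton.elim _ _
  · rw [Matrix.trace_smul, Matrix.trace_one, smul_eq_mul, mul_eq_zero] at h
    rw [h.resolve_right (Nat.cast_ne_zero.2 Fintype.card_ne_zero), zero_smul]

/-- The linear map `(V, W) ↦ (A b V - W A b)_b` for `V` of trace zero, as a function of `A`. The
trace condition removes the scalar solutions `V = W = c • 1`. -/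
noncomputable def intertwinerMap : (B → I → I → ℂ) →ₗ[ℝ]
    ((Matrix.traceLinearMap I ℂ ℂ).ker × Matrix I I ℂ) →ₗ[ℂ] (B → Matrix I I ℂ) :=
  LinearMap.mk₂' ℝ ℂ (fun A X b => Matrix.of (A b) * X.1.1 - X.2 * Matrix.of (A b))
    (fun A A' X => by
      funext b
      simp only [Pi.add_apply, ← Matrix.of_add_of, add_mul, mul_add]
      abel)
    (fun r A X => by
      funext b
      simp only [Pi.smul_apply, ← Matrix.smul_of, Matrix.smul_mul, Matrix.mul_smul, smul_sub])
    (fun A X X' => by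
      funext b
      simp only [Prod.fst_add, Prod.snd_add, Submodule.coe_add, Pi.add_apply, add_mul, mul_add]
      abel)
    (fun c A X => by
      funext b
      simp only [Prod.smul_fst, Prod.smul_snd, Submodule.coe_smul, Pi.smul_apply, Matrix.smul_mul,
        Matrix.mul_smul, smul_sub])

theorem ae_intertwiner_scalar [Fintype B] (hB : 3 ≤ Fintype.card B) (μ : Measure (B → I → I → ℂ))
    [μ.IsAddHaarMeasure] :
    ∀ᵐ A ∂μ, ∀ V W : Matrix I I ℂ, (∀ b, Matrix.of (A b) * V = W * Matrix.of (A b)) →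
      ∃ c : ℂ, V = c • 1 := by
  obtain ⟨A₀, hA₀⟩ := exists_intertwiner_scalar (I := I) hB
  have h₀ : Function.Injective (intertwinerMap (I := I) fun b => A₀ b) := by
    rw [← LinearMap.ker_eq_bot, LinearMap.ker_eq_bot']
    rintro ⟨⟨V, hV⟩, W⟩ h
    obtain ⟨rfl, c, rfl⟩ := hA₀ V W fun b => sub_eq_zero.1 (congrFun h b)
    have hzero := smul_one_eq_zero_of_trace_eq_zero hV
    exact Prod.ext (Subtype.ext hzero) hzero
  refine (ae_injective_of_linear_family μ intertwinerMap h₀).mono fun A hA V W h => ?_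
  obtain ⟨c, hc⟩ := exists_trace_sub_smul_one_eq_zero V
  have hker : intertwinerMap A (⟨V - c • 1, hc⟩, W - c • 1) = 0 := by
    funext b
    simp [intertwinerMap, mul_sub, sub_mul, h b]
  have hV := congrArg (fun X => X.1.1) (hA (hker.trans (map_zero _).symm))
  exact ⟨c, sub_eq_zero.1 hV⟩

end Intertwiners

section Range

open Matrix

theorem exists_eq_mul_conjTranspose_of_posSemidef {X : Type*} [Finite X] {A : Matrix X X ℂ}
    (hA : A.PosSemidef) : ∃ (m : ℕ) (V : Matrix X (Fin m) ℂ), A = V * Vᴴ := by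
  obtain ⟨m, v, rfl⟩ := posSemidef_iff_eq_sum_vecMulVec.1 hA
  refine ⟨m, of fun x k => v k x, ?_⟩
  ext x y
  simp [mul_apply, Matrix.sum_apply, vecMulVec_apply]

variable {X Z : Type*} [Fintype X] [Fintype Z]

theorem range_mulVecLin_mul_conjTranspose (V : Matrix X Z ℂ) :
    (V * Vᴴ).mulVecLin.range = V.mulVecLin.range := by
  refine Submodule.eq_of_le_of_finrank_eq ?_ V.rank_self_mul_conjTranspose
  rw [mulVecLin_mul]
  exact LinearMap.range_comp_le_range _ _

theorem range_mulVecLin_le_of_posSemidef_sub {A B : Matrix X X ℂ} (hA : A.PosSemidef)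
    (hAB : (B - A).PosSemidef) : A.mulVecLin.range ≤ B.mulVecLin.range := by
  obtain ⟨m, V, rfl⟩ := exists_eq_mul_conjTranspose_of_posSemidef hA
  obtain ⟨n, W, hW⟩ := exists_eq_mul_conjTranspose_of_posSemidef hAB
  have hB : B = fromCols V W * (fromCols V W)ᴴ := by
    rw [conjTranspose_fromCols_eq_fromRows_conjTranspose, fromCols_mul_fromRows, ← hW,
      add_sub_cancel]
  rw [hB, range_mulVecLin_mul_conjTranspose, range_mulVecLin_mul_conjTranspose]
  rintro _ ⟨c, rfl⟩
  exact ⟨Sum.elim c 0, by simp [fromCols_mulVec]⟩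

theorem range_mulVecLin_le_range_sum {ι : Type*} [Fintype ι] {A : ι → Matrix X X ℂ}
    (hA : ∀ i, (A i).PosSemidef) (i : ι) :
    (A i).mulVecLin.range ≤ (∑ j, A j).mulVecLin.range := by
  classical
  refine range_mulVecLin_le_of_posSemidef_sub (hA i) ?_
  rw [← Finset.sum_erase_eq_sub (mem_univ i)]
  exact posSemidef_sum _ fun j _ => hA j

theorem exists_eq_mul_of_range_mulVecLin_le {X Y Z : Type*} [Fintype Y] [Fintype Z]
    {V : Matrix X Z ℂ} {W : Matrix X Y ℂ}
    (h : W.mulVecLin.range ≤ V.mulVecLin.range) : ∃ C : Matrix Z Y ℂ, W = V * C := by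
  classical
  have hcol : ∀ y, ∃ c : Z → ℂ, V *ᵥ c = W.col y := fun y => by
    obtain ⟨c, hc⟩ := h (LinearMap.mem_range_self W.mulVecLin (Pi.single y 1))
    exact ⟨c, by simpa using hc⟩
  choose C hC using hcol
  exact ⟨of fun z y => C y z, Matrix.ext fun x y => (congrFun (hC y) x).symm⟩

end Range

section RangeCriterion

open Matrix

variable {I J : Type*} [Fintype I] [Fintype J]

theorem kronecker_mulVec_mul (σ : Matrix I I ℂ) (τ : Matrix J J ℂ) (a : I → ℂ) (b : J → ℂ) :
    (σ ⊗ₖ τ) *ᵥ (fun w => a w.1 * b w.2) = fun w => (σ *ᵥ a) w.1 * (τ *ᵥ b) w.2 := by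
  ext w
  simp only [mulVec, dotProduct, kroneckerMap_apply, Fintype.sum_prod_type, Finset.sum_mul_sum]
  exact Finset.sum_congr rfl fun x _ => Finset.sum_congr rfl fun y _ => mul_mul_mul_comm _ _ _ _

theorem IsDensityMatrix.exists_mulVec_ne_zero {σ : Matrix I I ℂ} (hσ : IsDensityMatrix σ) :
    ∃ a x, (σ *ᵥ a) x ≠ 0 := by
  classical
  by_contra! h
  have hzero : σ = 0 := Matrix.ext fun x y => by simpa using h (Pi.single y 1) x
  simpa [hzero] using hσ.2

/-- The range criterion of P. Horodecki. -/
theorem IsSeparableState.not_completelyEntangled_range {ρ : Matrix (I × J) (I × J) ℂ}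
    (hρ : IsSeparableState ρ) : ¬ CompletelyEntangled ρ.mulVecLin.range := by
  obtain ⟨n, p, σ, τ, hp, hp1, hσ, hτ, rfl⟩ := hρ
  intro hent
  obtain ⟨i, -, hi⟩ : ∃ i ∈ univ, p i ≠ 0 :=
    Finset.exists_ne_zero_of_sum_ne_zero (hp1.trans_ne one_ne_zero)
  have hpos : ∀ i, ((p i : ℂ) • (σ i ⊗ₖ τ i)).PosSemidef := fun i =>
    ((hσ i).1.kronecker (hτ i).1).smul (Complex.zero_le_real.2 (hp i))
  obtain ⟨a, x, hx⟩ := (hσ i).exists_mulVec_ne_zero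
  obtain ⟨b, y, hy⟩ := (hτ i).exists_mulVec_ne_zero
  have hmem : (fun w => (p i * (σ i *ᵥ a) w.1) * (τ i *ᵥ b) w.2) ∈
      (∑ i, (p i : ℂ) • (σ i ⊗ₖ τ i)).mulVecLin.range := by
    refine range_mulVecLin_le_range_sum hpos i ⟨fun w => a w.1 * b w.2, ?_⟩
    rw [mulVecLin_apply, smul_mulVec, kronecker_mulVec_mul]
    ext w
    exact (mul_assoc _ _ _).symm
  have hzero := congrFun (hent _ hmem ⟨fun x => p i * (σ i *ᵥ a) x, τ i *ᵥ b, rfl⟩) (x, y)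
  exact mul_ne_zero (mul_ne_zero (Complex.ofReal_ne_zero.2 hi) hx) hy hzero

end RangeCriterion

section Locality

open Matrix

variable {ι : Type*} [DecidableEq ι] {d : ℕ} {S : Finset ι}

theorem splitEquiv_symm_apply (S : Finset ι) (x : {i // i ∈ S} → Fin d)
    (z : {i // i ∉ S} → Fin d) (i : ι) :
    (splitEquiv d S).symm (x, z) i = if h : i ∈ S then x ⟨i, h⟩ else z ⟨i, h⟩ :=
  rfl

theorem piecewise_splitEquiv_symm (S : Finset ι) (x x' : {i // i ∈ S} → Fin d)
    (z z' : {i // i ∉ S} → Fin d) :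
    S.piecewise ((splitEquiv d S).symm (x, z)) ((splitEquiv d S).symm (x', z'))
      = (splitEquiv d S).symm (x, z') := by
  ext i
  by_cases hi : i ∈ S <;> simp [splitEquiv_symm_apply, hi]

/-- The matrices on `(ℂ^d)^{⊗ ι}` acting as the identity on the parties in `S`, i.e. those of the
form `1 ⊗ V` with `V` acting on the parties outside `S`. The condition is imposed party by party, so
that being trivial on a union of sets amounts to being trivial on each of them. -/
def IsTrivialOn (S : Finset ι) (X : Matrix (ι → Fin d) (ι → Fin d) ℂ) : Prop :=
  ∀ i ∈ S, (∀ x y, x i ≠ y i → X x y = 0) ∧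
    ∀ x y a, x i = y i → X (Function.update x i a) (Function.update y i a) = X x y

namespace IsTrivialOn

variable {X Y : Matrix (ι → Fin d) (ι → Fin d) ℂ}

theorem mono {T : Finset ι} (hX : IsTrivialOn S X) (hTS : T ⊆ S) : IsTrivialOn T X :=
  fun i hi => hX i (hTS hi)

theorem sub (hX : IsTrivialOn S X) (hY : IsTrivialOn S Y) : IsTrivialOn S (X - Y) := by
  refine fun i hi => ⟨fun x y hxy => ?_, fun x y a hxy => ?_⟩
  · rw [Matrix.sub_apply, (hX i hi).1 x y hxy, (hY i hi).1 x y hxy, sub_zero]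
  · rw [Matrix.sub_apply, Matrix.sub_apply, (hX i hi).2 x y a hxy, (hY i hi).2 x y a hxy]

theorem apply_piecewise (hX : IsTrivialOn S X) (u : ι → Fin d) {x y : ι → Fin d}
    (hxy : ∀ i ∈ S, x i = y i) : X (S.piecewise u x) (S.piecewise u y) = X x y := by
  induction S using Finset.induction_on with
  | empty => simp only [Finset.piecewise_empty]
  | insert i S hi ih =>
    rw [Finset.piecewise_insert, Finset.piecewise_insert, (hX i (mem_insert_self i S)).2]
    · exact ih (hX.mono (subset_insert i S)) fun j hj => hxy j (mem_insert_of_mem hj)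
    · simpa [hi] using hxy i (mem_insert_self i S)

theorem eq_smul_one_of_univ [Fintype ι] (hX : IsTrivialOn univ X) : ∃ c : ℂ, X = c • 1 := by
  rcases isEmpty_or_nonempty (ι → Fin d) with _ | ⟨⟨u⟩⟩
  · exact ⟨0, Subsingleton.elim _ _⟩
  refine ⟨X u u, ?_⟩
  ext x y
  rcases eq_or_ne x y with rfl | hxy
  · simpa using (hX.apply_piecewise u fun i _ => rfl).symm
  · obtain ⟨i, hi⟩ := Function.ne_iff.1 hxy
    simpa [hxy] using (hX i (mem_univ i)).1 x y hi

end IsTrivialOn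

/-- The coefficients of `ψ ∈ (ℂ^d)^{⊗ S} ⊗ (ℂ^d)^{⊗ Sᶜ}` as a matrix; its columns are the vectors of
`(ℂ^d)^{⊗ S}` paired with the basis of `(ℂ^d)^{⊗ Sᶜ}`. -/
def coeffMatrix (S : Finset ι) (ψ : (ι → Fin d) → ℂ) :
    Matrix ({i // i ∈ S} → Fin d) ({i // i ∉ S} → Fin d) ℂ :=
  of fun x z => ψ ((splitEquiv d S).symm (x, z))

theorem coeffMatrix_injective (S : Finset ι) :
    Function.Injective (coeffMatrix (d := d) S) := fun ψ φ h => by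
  ext w
  obtain ⟨w, rfl⟩ := (splitEquiv d S).symm.surjective w
  exact congrFun (congrFun h w.1) w.2

theorem isTrivialOn_one_kronecker (V : Matrix ({i // i ∉ S} → Fin d) ({i // i ∉ S} → Fin d) ℂ) :
    IsTrivialOn S ((1 ⊗ₖ V).submatrix (splitEquiv d S) (splitEquiv d S)) := by
  refine fun i hi => ⟨fun x y hxy => ?_, fun x y a hxy => ?_⟩
  · have hne : (splitEquiv d S x).1 ≠ (splitEquiv d S y).1 := fun h => hxy (congrFun h ⟨i, hi⟩)
    simp [hne]
  · have hout : ∀ w, (splitEquiv d S (Function.update w i a)).2 = (splitEquiv d S w).2 :=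
      fun w => funext fun j => Function.update_of_ne (fun hj => j.2 (by rwa [hj])) _ _
    have hin : (splitEquiv d S (Function.update x i a)).1
        = (splitEquiv d S (Function.update y i a)).1
          ↔ (splitEquiv d S x).1 = (splitEquiv d S y).1 := by
      simp only [funext_iff]
      refine forall_congr' fun j => ?_
      by_cases hj : j.1 = i <;> simp [splitEquiv, hj, hxy]
    simp only [submatrix_apply, kroneckerMap_apply, one_apply, hout, hin]

variable [Fintype ι]

theorem IsTrivialOn.coeffMatrix_mulVec {X : Matrix (ι → Fin d) (ι → Fin d) ℂ}
    (hX : IsTrivialOn S X) (x : {i // i ∈ S} → Fin d) (ψ : (ι → Fin d) → ℂ) :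
    coeffMatrix S (X *ᵥ ψ) = coeffMatrix S ψ * (of fun z z' =>
      X ((splitEquiv d S).symm (x, z)) ((splitEquiv d S).symm (x, z')))ᵀ := by
  ext y z
  have hoff : ∀ y' z', y' ≠ y →
      X ((splitEquiv d S).symm (y, z)) ((splitEquiv d S).symm (y', z')) = 0 := by
    intro y' z' hne
    obtain ⟨i, hi⟩ := Function.ne_iff.1 hne
    exact (hX i i.2).1 _ _ (by simpa [splitEquiv_symm_apply] using hi.symm)
  have hblock : ∀ z', X ((splitEquiv d S).symm (x, z)) ((splitEquiv d S).symm (x, z'))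
      = X ((splitEquiv d S).symm (y, z)) ((splitEquiv d S).symm (y, z')) := by
    intro z'
    rw [← piecewise_splitEquiv_symm S x y z z, ← piecewise_splitEquiv_symm S x y z z']
    exact hX.apply_piecewise _ fun i hi => by simp [splitEquiv_symm_apply, hi]
  calc (X *ᵥ ψ) ((splitEquiv d S).symm (y, z))
      = ∑ y', ∑ z', X ((splitEquiv d S).symm (y, z)) ((splitEquiv d S).symm (y', z'))
          * ψ ((splitEquiv d S).symm (y', z')) := by
        rw [mulVec, dotProduct, ← (splitEquiv d S).symm.sum_comp, Fintype.sum_prod_type]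
    _ = ∑ z', X ((splitEquiv d S).symm (y, z)) ((splitEquiv d S).symm (y, z'))
          * ψ ((splitEquiv d S).symm (y, z')) :=
        Fintype.sum_eq_single y fun y' hne =>
          Finset.sum_eq_zero fun z' _ => by rw [hoff y' z' hne, zero_mul]
    _ = _ := Finset.sum_congr rfl fun z' _ => by
        rw [← hblock, mul_comm]
        rfl

theorem exists_isTrivialOn_mulVec_eq_iff {ψ φ : (ι → Fin d) → ℂ} :
    (∃ X, IsTrivialOn S X ∧ X *ᵥ ψ = φ) ↔
      ∃ C : Matrix ({i // i ∉ S} → Fin d) ({i // i ∉ S} → Fin d) ℂ,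
        coeffMatrix S φ = coeffMatrix S ψ * C := by
  constructor
  · rintro ⟨X, hX, rfl⟩
    rcases isEmpty_or_nonempty ({i // i ∈ S} → Fin d) with _ | ⟨⟨x⟩⟩
    · exact ⟨0, Subsingleton.elim _ _⟩
    · exact ⟨_, hX.coeffMatrix_mulVec x ψ⟩
  · rintro ⟨C, hC⟩
    refine ⟨_, isTrivialOn_one_kronecker Cᵀ, coeffMatrix_injective S ?_⟩
    ext x z
    rw [hC, (isTrivialOn_one_kronecker Cᵀ).coeffMatrix_mulVec x]
    simp [mul_apply]

/-- A vector `ψ` is rigid with respect to the sets of parties in `G` if only its multiples can be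
obtained from it, for every `S ∈ G`, by an operator acting outside `S`. -/
def IsRigid (G : Finset (Finset ι)) (ψ : (ι → Fin d) → ℂ) : Prop :=
  ∀ φ, (∀ S ∈ G, ∃ X, IsTrivialOn S X ∧ X *ᵥ ψ = φ) → ∃ c : ℂ, φ = c • ψ

theorem IsRigid.mono {G G' : Finset (Finset ι)} {ψ : (ι → Fin d) → ℂ} (h : IsRigid G' ψ)
    (hG : ∀ S' ∈ G', ∃ S ∈ G, S' ⊆ S) : IsRigid G ψ := by
  refine fun φ hφ => h φ fun S' hS' => ?_
  obtain ⟨S, hS, hsub⟩ := hG S' hS'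
  obtain ⟨X, hX, rfl⟩ := hφ S hS
  exact ⟨X, hX.mono hsub, rfl⟩

theorem IsTrivialOn.eq_zero_of_mulVec_eq_zero {X : Matrix (ι → Fin d) (ι → Fin d) ℂ}
    (hX : IsTrivialOn S X) {ψ : (ι → Fin d) → ℂ} (hψ : LinearIndependent ℂ (coeffMatrix S ψ).col)
    (h : X *ᵥ ψ = 0) : X = 0 := by
  ext w w'
  obtain ⟨⟨x, z⟩, rfl⟩ := (splitEquiv d S).symm.surjective w
  obtain ⟨⟨x', z'⟩, rfl⟩ := (splitEquiv d S).symm.surjective w'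
  by_cases hx : x = x'
  · subst hx
    have hrow : coeffMatrix S ψ *ᵥ
        (fun z' => X ((splitEquiv d S).symm (x, z)) ((splitEquiv d S).symm (x, z'))) = 0 := by
      ext y
      have hentry := congrFun (congrFun (hX.coeffMatrix_mulVec x ψ) y) z
      rw [h] at hentry
      exact hentry.symm
    have hinj := mulVec_injective_iff.2 hψ
    exact congrFun (hinj (hrow.trans (mulVec_zero _).symm)) z'
  · obtain ⟨i, hi⟩ := Function.ne_iff.1 hx
    exact (hX i i.2).1 _ _ (by simpa [splitEquiv_symm_apply] using hi)

theorem isRigid_of_subset {G : Finset (Finset ι)} {K : Finset ι} (hG : G.Nonempty)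
    (hK : ∀ S ∈ G, K ⊆ S) (hcover : ∀ i, ∃ S ∈ G, i ∈ S) {ψ : (ι → Fin d) → ℂ}
    (hψ : LinearIndependent ℂ (coeffMatrix K ψ).col) : IsRigid G ψ := by
  intro φ hφ
  obtain ⟨S₀, hS₀⟩ := hG
  obtain ⟨X, hX, rfl⟩ := hφ S₀ hS₀
  have htriv : ∀ S ∈ G, IsTrivialOn S X := fun S hS => by
    obtain ⟨Y, hY, hYX⟩ := hφ S hS
    have hzero := ((hX.mono (hK S₀ hS₀)).sub (hY.mono (hK S hS))).eq_zero_of_mulVec_eq_zero hψ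
      (by rw [sub_mulVec, hYX, sub_self])
    rwa [sub_eq_zero.1 hzero]
  obtain ⟨c, rfl⟩ := IsTrivialOn.eq_smul_one_of_univ (X := X) fun i _ => by
    obtain ⟨S, hS, hi⟩ := hcover i
    exact htriv S hS i hi
  exact ⟨c, by rw [smul_mulVec, one_mulVec]⟩

end Locality

section PureStates

open Matrix

variable {N d : ℕ}

theorem trace_pureDensity {ψ : QuditSpace N d} (hψ : ‖ψ‖ = 1) : (pureDensity ψ).trace = 1 := by
  have hsum := EuclideanSpace.norm_sq_eq ψ
  rw [hψ, one_pow] at hsum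
  simp only [pureDensity, trace, diag_apply, of_apply, Complex.star_def, Complex.mul_conj,
    Complex.normSq_eq_norm_sq]
  exact_mod_cast hsum.symm

theorem isDensityMatrix_pureDensity {ψ : QuditSpace N d} (hψ : ‖ψ‖ = 1) :
    IsDensityMatrix (pureDensity ψ) :=
  ⟨posSemidef_vecMulVec_self_star (ψ : (Fin N → Fin d) → ℂ), trace_pureDensity hψ⟩

theorem exists_coeffMatrix_col_eq_mul {m : ℕ} {Φ : Matrix (Fin N → Fin d) (Fin m) ℂ}
    {ψ : QuditSpace N d} {S : Finset (Fin N)}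
    (h : marginal S (Φ * Φᴴ) = marginal S (pureDensity ψ)) (k : Fin m) :
    ∃ C : Matrix ({i // i ∉ S} → Fin d) ({i // i ∉ S} → Fin d) ℂ,
      coeffMatrix S (Φ.col k) = coeffMatrix S ψ * C := by
  let W : Matrix ({i // i ∈ S} → Fin d) (({i // i ∉ S} → Fin d) × Fin m) ℂ :=
    of fun x z => Φ ((splitEquiv d S).symm (x, z.1)) z.2
  have hW : W * Wᴴ = coeffMatrix S ψ * (coeffMatrix S ψ)ᴴ := by
    refine Eq.trans ?_ h
    ext x y
    simp only [marginal, mul_apply, Fintype.sum_prod_type]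
    rfl
  have hrange : W.mulVecLin.range ≤ (coeffMatrix S ψ).mulVecLin.range := by
    rw [← range_mulVecLin_mul_conjTranspose W, hW, range_mulVecLin_mul_conjTranspose]
  obtain ⟨C, hC⟩ := exists_eq_mul_of_range_mulVecLin_le hrange
  exact ⟨of fun z' z => C z' (z, k), Matrix.ext fun x z => congrFun (congrFun hC x) (z, k)⟩

theorem mul_conjTranspose_eq_smul_pureDensity {m : ℕ} {Φ : Matrix (Fin N → Fin d) (Fin m) ℂ}
    {ψ : QuditSpace N d} {c : Fin m → ℂ} (h : ∀ k, Φ.col k = c k • ψ.ofLp) :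
    Φ * Φᴴ = (∑ k, c k * star (c k)) • pureDensity ψ := by
  ext x y
  have hΦ : ∀ w k, Φ w k = c k * ψ w := fun w k => congrFun (h k) w
  simp only [mul_apply, conjTranspose_apply, hΦ, star_mul', Matrix.smul_apply, pureDensity,
    of_apply, smul_eq_mul, Finset.sum_mul, mul_mul_mul_comm]

theorem eq_pureDensity_of_isCompatible {ψ : QuditSpace N d} (hψ : ‖ψ‖ = 1)
    {G : Finset (Finset (Fin N))} (hG : IsRigid G ψ)
    {η : Matrix (Fin N → Fin d) (Fin N → Fin d) ℂ}
    (hη : IsCompatible G (fun S => marginal S (pureDensity ψ)) η) : η = pureDensity ψ := by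
  obtain ⟨⟨hpos, htrace⟩, hmarginal⟩ := hη
  obtain ⟨m, Φ, rfl⟩ := exists_eq_mul_conjTranspose_of_posSemidef hpos
  choose c hc using fun k => hG (Φ.col k) fun S hS =>
    exists_isTrivialOn_mulVec_eq_iff.2 (exists_coeffMatrix_col_eq_mul (hmarginal S hS) k)
  rw [mul_conjTranspose_eq_smul_pureDensity hc] at htrace ⊢
  rw [trace_smul, trace_pureDensity hψ, smul_eq_mul, mul_one] at htrace
  rw [htrace, one_smul]

theorem entangledAcross_marginal_pureDensity {ψ : QuditSpace N d} {R : Finset (Fin N)}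
    {A : Finset {i // i ∈ R}}
    (h : CompletelyEntangled (Submodule.span ℂ
      (Set.range ((coeffMatrix R ψ).submatrix (splitEquiv d A).symm id).col))) :
    EntangledAcross (marginal R (pureDensity ψ)) A := by
  refine fun hsep => hsep.not_completelyEntangled_range ?_
  rwa [← range_mulVecLin, ← range_mulVecLin_mul_conjTranspose] at h

theorem exhibitsTransitivity_of_isRigid {G : Finset (Finset (Fin N))} {ψ : QuditSpace N d}
    (hψ : ‖ψ‖ = 1) (hG : ∀ S ∈ G, SizeThreshold d N #S)
    (hent : ∀ R, SizeThreshold d N #R → EntangledAcrossAllCuts (marginal R (pureDensity ψ)))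
    (hrigid : IsRigid G ψ) :
    ExhibitsTransitivity G (fun S => marginal S (pureDensity ψ)) (remainingLarge d G) where
  compatible := ⟨pureDensity ψ, isDensityMatrix_pureDensity hψ, fun _ _ => rfl⟩
  given_entangled S hS := hent S (hG S hS)
  forced_entangled η hη R hR := by
    rw [eq_pureDensity_of_isCompatible hψ hrigid hη]
    exact hent R hR.2

end PureStates

section TwoSets

open Matrix

variable {ι : Type*} [Fintype ι] [DecidableEq ι] {d : ℕ} {S T : Finset ι}

/-- The configurations of two overlapping groups `S` and `T` of parties which together comprise all
parties, in terms of the parties in `S ∩ T`, outside `T`, and outside `S`. -/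
def tripleEquiv (d : ℕ) (hST : S ∪ T = univ) :
    ({i // i ∈ S ∩ T} → Fin d) × ({i // i ∉ T} → Fin d) × ({i // i ∉ S} → Fin d)
      ≃ (ι → Fin d) where
  toFun w i :=
    if hT : i ∉ T then w.2.1 ⟨i, hT⟩
    else if hS : i ∉ S then w.2.2 ⟨i, hS⟩
    else w.1 ⟨i, mem_inter.2 ⟨not_not.1 hS, not_not.1 hT⟩⟩
  invFun x := (fun i => x i, fun i => x i, fun i => x i)
  left_inv w := by
    have hor : ∀ i, i ∈ S ∨ i ∈ T := fun i => mem_union.1 (hST ▸ mem_univ i)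
    refine Prod.ext (funext fun i => ?_) (Prod.ext (funext fun i => ?_) (funext fun i => ?_))
    · simp [(mem_inter.1 i.2).1, (mem_inter.1 i.2).2]
    · simp [i.2]
    · simp [i.2, (hor i).resolve_left i.2]
  right_inv x := by
    funext i
    dsimp only
    split_ifs <;> rfl

theorem splitEquiv_symm_tripleEquiv_left (hST : S ∪ T = univ) (a : {i // i ∉ T} → Fin d)
    (b : {i // i ∈ S ∩ T} → Fin d) (c c' : {i // i ∉ S} → Fin d) :
    (splitEquiv d S).symm (fun i => tripleEquiv d hST (b, a, c) i, c')
      = tripleEquiv d hST (b, a, c') := by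
  ext i
  have hor : i ∈ S ∨ i ∈ T := mem_union.1 (hST ▸ mem_univ i)
  by_cases hS : i ∈ S <;> by_cases hT : i ∈ T <;>
    simp_all [splitEquiv_symm_apply, tripleEquiv]

theorem splitEquiv_symm_tripleEquiv_right (hST : S ∪ T = univ) (a a' : {i // i ∉ T} → Fin d)
    (b : {i // i ∈ S ∩ T} → Fin d) (c : {i // i ∉ S} → Fin d) :
    (splitEquiv d T).symm (fun i => tripleEquiv d hST (b, a, c) i, a')
      = tripleEquiv d hST (b, a', c) := by
  ext i
  have hor : i ∈ S ∨ i ∈ T := mem_union.1 (hST ▸ mem_univ i)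
  by_cases hS : i ∈ S <;> by_cases hT : i ∈ T <;>
    simp_all [splitEquiv_symm_apply, tripleEquiv]

theorem isRigid_pair (hST : S ∪ T = univ)
    (f : ({i // i ∉ T} → Fin d) ≃ ({i // i ∉ S} → Fin d)) {ψ : (ι → Fin d) → ℂ}
    (hψ : ∀ V W : Matrix ({i // i ∉ T} → Fin d) ({i // i ∉ T} → Fin d) ℂ,
      (∀ b, (of fun a c => ψ (tripleEquiv d hST (b, a, f c))) * V
        = W * of fun a c => ψ (tripleEquiv d hST (b, a, f c))) → ∃ c : ℂ, V = c • 1) :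
    IsRigid {S, T} ψ := by
  intro φ hφ
  obtain ⟨V, hV⟩ := exists_isTrivialOn_mulVec_eq_iff.1 (hφ S (by simp))
  obtain ⟨W, hW⟩ := exists_isTrivialOn_mulVec_eq_iff.1 (hφ T (by simp))
  have hφV : ∀ b, (of fun a c => φ (tripleEquiv d hST (b, a, f c)))
      = (of fun a c => ψ (tripleEquiv d hST (b, a, f c))) * V.submatrix f f := fun b => by
    ext a c
    have h := congrFun (congrFun hV fun i => tripleEquiv d hST (b, a, f c) i) (f c)
    simp only [coeffMatrix, mul_apply, of_apply, splitEquiv_symm_tripleEquiv_left] at h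
    rw [of_apply, h, ← f.sum_comp]
    rfl
  have hφW : ∀ b, (of fun a c => φ (tripleEquiv d hST (b, a, f c)))
      = Wᵀ * (of fun a c => ψ (tripleEquiv d hST (b, a, f c))) := fun b => by
    ext a c
    have h := congrFun (congrFun hW fun i => tripleEquiv d hST (b, a, f c) i) a
    simp only [coeffMatrix, mul_apply, of_apply, splitEquiv_symm_tripleEquiv_right] at h
    simp only [of_apply, h, mul_apply, transpose_apply, mul_comm]
  obtain ⟨c, hc⟩ := hψ (V.submatrix f f) Wᵀ fun b => (hφV b).symm.trans (hφW b)
  refine ⟨c, funext fun w => ?_⟩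
  obtain ⟨⟨b, a, z⟩, rfl⟩ := (tripleEquiv d hST).surjective w
  obtain ⟨y, rfl⟩ := f.surjective z
  have h := congrFun (congrFun (hφV b) a) y
  rw [hc, mul_smul_one] at h
  exact h

end TwoSets

section Thresholds

variable {d N a b c k : ℕ}

theorem lt_two_mul_of_sizeThreshold (h : SizeThreshold d N k) : N < 2 * k := by
  unfold SizeThreshold at h
  split_ifs at h <;> omega

theorem three_le_pow_of_sizeThreshold (hd : 2 ≤ d) (h : SizeThreshold d N k) :
    3 ≤ d ^ (2 * k - N) := by
  unfold SizeThreshold at h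
  split_ifs at h with h2
  · calc 3 ≤ d ^ 2 := by rw [h2]; norm_num
      _ ≤ d ^ (2 * k - N) := Nat.pow_le_pow_right (by omega) (by omega)
  · calc 3 ≤ d ^ 1 := by rw [pow_one]; omega
      _ ≤ d ^ (2 * k - N) := Nat.pow_le_pow_right (by omega) (by omega)

theorem pow_add_pow_add_pow_le (hd : 2 ≤ d) (ha : a ≠ 0) (hb : b ≠ 0)
    (h : SizeThreshold d (a + b + c) (a + b)) :
    d ^ c + d ^ a + d ^ b ≤ d ^ a * d ^ b + 1 := by
  have hda : d ≤ d ^ a := Nat.le_self_pow ha d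
  have hdb : d ≤ d ^ b := Nat.le_self_pow hb d
  unfold SizeThreshold at h
  split_ifs at h with h2
  · have hc : 4 * d ^ c ≤ d ^ a * d ^ b := by
      rw [← pow_add, show 4 = d ^ 2 by rw [h2]; norm_num, ← pow_add]
      exact Nat.pow_le_pow_right (by omega) (by omega)
    nlinarith [Nat.mul_le_mul (hd.trans hda) (hd.trans hdb)]
  · have hd3 : 3 ≤ d := by omega
    have hc : 3 * d ^ c ≤ d ^ a * d ^ b := by
      refine (Nat.mul_le_mul_right _ hd3).trans ?_
      rw [← pow_add, ← pow_succ']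
      exact Nat.pow_le_pow_right (by omega) (by omega)
    nlinarith [Nat.mul_le_mul (hd3.trans hda) (hd3.trans hdb)]

end Thresholds

section Haar

open Matrix

variable {N d : ℕ}

theorem ae_haarPureState_of_ae {F : Type*} [NormedAddCommGroup F] [NormedSpace ℝ F]
    [FiniteDimensional ℝ F] [MeasurableSpace F] [BorelSpace F] (ν : Measure F)
    [ν.IsAddHaarMeasure] (e : QuditSpace N d ≃ₗ[ℝ] F) {P : F → Prop} (hP : ∀ᵐ y ∂ν, P y)
    (hscale : ∀ y, ∀ r : ℝ, 0 < r → P (r • y) → P y) : ∀ᵐ ψ ∂haarPureState N d, P (e ψ.1) := by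
  obtain ⟨c, -, hc⟩ := e.toLinearMap.exists_map_addHaar_eq_smul_addHaar volume ν e.surjective
  have hmap : ∀ᵐ y ∂(volume.map e.toLinearMap), P y := by
    rw [hc]
    exact Measure.ae_smul_measure hP c
  refine Measure.ae_smul_measure (ae_toSphere_of_ae volume (P := fun ψ => P (e ψ))
    (ae_of_ae_map e.toLinearMap.continuous_of_finiteDimensional.aemeasurable hmap)
    fun ψ r hr h => hscale _ r hr ?_) _
  rwa [← map_smul]

/-- The coefficients of a vector, sorted by two indices, as a real-linear isomorphism: along it,
almost everywhere statements on families of vectors are pulled back to `haarPureState`. -/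
noncomputable def coeffEquiv {Z X : Type*} (f : Z × X ≃ (Fin N → Fin d)) :
    QuditSpace N d ≃ₗ[ℝ] (Z → X → ℂ) :=
  (WithLp.linearEquiv 2 ℝ ((Fin N → Fin d) → ℂ)).trans
    ((LinearEquiv.funCongrLeft ℝ ℂ f).trans (LinearEquiv.curry ℝ ℂ Z X))

theorem linearIndependent_of_real_smul {Z V : Type*} [AddCommGroup V] [Module ℂ V] {v : Z → V}
    {r : ℝ} (h : LinearIndependent ℂ (r • v)) : LinearIndependent ℂ v := by
  have hcomp : r • v = ((r : ℂ) • (LinearMap.id : V →ₗ[ℂ] V)) ∘ v :=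
    funext fun z => (Complex.coe_smul r (v z)).symm
  rw [hcomp] at h
  exact h.of_comp

theorem ae_linearIndependent_coeffMatrix_col (hd : d ≠ 0) {K : Finset (Fin N)} (hK : N ≤ 2 * #K) :
    ∀ᵐ ψ ∂haarPureState N d, LinearIndependent ℂ (coeffMatrix K ψ.1).col := by
  let e := coeffEquiv ((Equiv.prodComm _ _).trans (splitEquiv d K).symm)
  have hcard : Fintype.card ({i // i ∉ K} → Fin d)
      ≤ Module.finrank ℂ (({i // i ∈ K} → Fin d) → ℂ) := by
    simp only [Fintype.card_fun, Fintype.card_fin, Fintype.card_subtype_compl, Fintype.card_coe,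
      Module.finrank_fintype_fun_eq_card]
    exact Nat.pow_le_pow_right (Nat.pos_of_ne_zero hd) (by omega)
  have hli := ae_linearIndependent Measure.addHaar hcard
  have hscale : ∀ (v : ({i // i ∉ K} → Fin d) → ({i // i ∈ K} → Fin d) → ℂ) (r : ℝ), 0 < r →
      LinearIndependent ℂ (r • v) → LinearIndependent ℂ v :=
    fun _ _ _ => linearIndependent_of_real_smul
  exact ae_haarPureState_of_ae Measure.addHaar e hli hscale

theorem ae_entangledAcrossAllCuts (hd : 2 ≤ d) :
    ∀ᵐ ψ ∂haarPureState N d, ∀ R : Finset (Fin N), SizeThreshold d N #R →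
      EntangledAcrossAllCuts (marginal R (pureDensity ψ.1)) := by
  refine ae_all_iff.2 fun R => Filter.eventually_imp_distrib_left.2 fun hR =>
    ae_all_iff.2 fun A => Filter.eventually_imp_distrib_left.2 fun hA =>
      Filter.eventually_imp_distrib_left.2 fun hA' => ?_
  let e := coeffEquiv ((Equiv.prodComm _ _).trans
    (((splitEquiv d A).symm.prodCongr (Equiv.refl _)).trans (splitEquiv d R).symm))
  refine (ae_haarPureState_of_ae Measure.addHaar e
    (P := fun v => CompletelyEntangled (Submodule.span ℂ (Set.range v)))
    (ae_completelyEntangled_span Measure.addHaar ?_) fun v r hr h => ?_).mono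
      fun ψ hψ => entangledAcross_marginal_pureDensity hψ
  · have hR' : #A + #Aᶜ = #R := by rw [card_add_card_compl, Fintype.card_coe]
    have hN : #A + #Aᶜ + #Rᶜ = N := by rw [hR', card_add_card_compl, Fintype.card_fin]
    have hle := pow_add_pow_add_pow_le (c := #Rᶜ) hd hA.card_pos.ne'
      (card_pos.2 (nonempty_iff_ne_empty.2 fun h => hA' ((compl_eq_empty_iff A).1 h))).ne'
      (by rwa [hN, hR'])
    simpa [card_compl] using hle
  · intro u hu
    refine h u (Submodule.span_le.2 ?_ hu)
    rintro _ ⟨z, rfl⟩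
    have hz : v z = (r : ℂ)⁻¹ • (r • v) z := by
      rw [Pi.smul_apply, ← Complex.coe_smul, inv_smul_smul₀ (Complex.ofReal_ne_zero.2 hr.ne')]
    rw [hz]
    exact Submodule.smul_mem _ _ (Submodule.subset_span ⟨z, rfl⟩)

end Haar

section Transitivity

open Matrix

variable {N d : ℕ} {S T K : Finset (Fin N)} {G : Finset (Finset (Fin N))}

theorem ae_haarPureState_intertwiner_scalar {B I : Type*} [Fintype B] [Fintype I] [DecidableEq I]
    (f : B × I × I ≃ (Fin N → Fin d)) (hB : 3 ≤ Fintype.card B) :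
    ∀ᵐ ψ ∂haarPureState N d, ∀ V W : Matrix I I ℂ,
      (∀ b, (of fun a c => ψ.1 (f (b, a, c))) * V = W * of fun a c => ψ.1 (f (b, a, c))) →
        ∃ c : ℂ, V = c • 1 := by
  let e := (coeffEquiv f).trans (LinearEquiv.piCongrRight fun _ => LinearEquiv.curry ℝ ℂ I I)
  refine ae_haarPureState_of_ae Measure.addHaar e (ae_intertwiner_scalar hB Measure.addHaar)
    fun A r _ hA V W hVW => hA V W fun b => ?_
  have hr : (of ((r • A) b) : Matrix I I ℂ) = r • of (A b) := rfl
  rw [hr, Matrix.smul_mul, hVW b, Matrix.mul_smul]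

theorem ae_isRigid_pair_of_card_eq (hd : 2 ≤ d) (hST : S ∪ T = univ) (hcard : #S = #T)
    (hS : SizeThreshold d N #S) : ∀ᵐ ψ ∂haarPureState N d, IsRigid {S, T} ψ.1.ofLp := by
  let f : ({i // i ∉ T} → Fin d) ≃ ({i // i ∉ S} → Fin d) :=
    Fintype.equivOfCardEq (by
      simp only [Fintype.card_fun, Fintype.card_fin, Fintype.card_subtype_compl, Fintype.card_coe,
        hcard])
  have hB : 3 ≤ Fintype.card ({i // i ∈ S ∩ T} → Fin d) := by
    have hinter : #(S ∩ T) = 2 * #S - N := by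
      have h := card_union_add_card_inter S T
      rw [hST, card_fin] at h
      omega
    rw [Fintype.card_fun, Fintype.card_fin, Fintype.card_coe, hinter]
    exact three_le_pow_of_sizeThreshold hd hS
  exact (ae_haarPureState_intertwiner_scalar
    (((Equiv.refl _).prodCongr ((Equiv.refl _).prodCongr f)).trans (tripleEquiv d hST)) hB).mono
      fun ψ hψ => isRigid_pair hST f hψ

theorem ae_isRigid_pair (hd : 2 ≤ d) (hST : S ∪ T = univ) (hS : SizeThreshold d N #S)
    (hT : SizeThreshold d N #T) : ∀ᵐ ψ ∂haarPureState N d, IsRigid {S, T} ψ.1.ofLp := by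
  wlog hle : #S ≤ #T generalizing S T
  · rw [Finset.pair_comm]
    exact this (by rwa [Finset.union_comm]) hT hS (le_of_not_ge hle)
  have hcompl : Sᶜ ⊆ T := fun i hi =>
    (mem_union.1 (hST ▸ mem_univ i)).resolve_left (mem_compl.1 hi)
  have hcompl_card : #Sᶜ ≤ #S := by
    have := lt_two_mul_of_sizeThreshold hS
    rw [card_compl, Fintype.card_fin]
    omega
  obtain ⟨T', hST', hT'T, hcard⟩ := exists_subsuperset_card_eq hcompl hcompl_card hle
  have hunion : S ∪ T' = univ := by
    rw [← univ_subset_iff, ← union_compl S]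
    exact union_subset_union_right hST'
  refine (ae_isRigid_pair_of_card_eq hd hunion hcard.symm hS).mono fun ψ h => h.mono ?_
  simp only [mem_insert, mem_singleton, forall_eq_or_imp, forall_eq, exists_eq_or_imp,
    exists_eq_left]
  exact ⟨Or.inl Subset.rfl, Or.inr hT'T⟩

theorem ae_exhibitsTransitivity_of_ae_isRigid (hd : 2 ≤ d) (hG : ∀ S ∈ G, SizeThreshold d N #S)
    (hrigid : ∀ᵐ ψ ∂haarPureState N d, IsRigid G ψ.1.ofLp) :
    ∀ᵐ ψ ∂haarPureState N d, ExhibitsTransitivity G (fun S => marginal S (pureDensity ψ.1))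
      (remainingLarge d G) := by
  filter_upwards [ae_entangledAcrossAllCuts hd, hrigid] with ψ hent hψ
  exact exhibitsTransitivity_of_isRigid (mem_sphere_zero_iff_norm.1 ψ.2) hG hent hψ

theorem union_eq_univ_of_card_inter (hS : #S = N / 2 + 1) (hT : #T = N / 2 + 1)
    (h : #(S ∩ T) = if Even N then 2 else 1) : S ∪ T = univ := by
  have hcard := card_union_add_card_inter S T
  rw [← card_eq_iff_eq_univ, Fintype.card_fin]
  split_ifs at h with hN
  · obtain ⟨m, rfl⟩ := hN
    omega
  · obtain ⟨m, rfl⟩ := Nat.not_even_iff_odd.1 hN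
    omega

theorem sizeThreshold_half_add_one (h : 3 ≤ d ∨ Even N) : SizeThreshold d N (N / 2 + 1) := by
  unfold SizeThreshold
  split_ifs with hd
  · obtain ⟨m, rfl⟩ := h.resolve_left (by omega)
    omega
  · omega

theorem sizeThreshold_card_insert {j : Fin N} (hj : j ∉ K) (hK : N ≤ 2 * #K) :
    SizeThreshold d N #(insert j K) := by
  rw [card_insert_of_notMem hj]
  unfold SizeThreshold
  split_ifs <;> omega

theorem exists_mem_image_insert_compl (hK : Kᶜ.Nonempty) (i : Fin N) :
    ∃ S ∈ Kᶜ.image fun j => insert j K, i ∈ S := by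
  obtain ⟨j, hj⟩ := hK
  by_cases hi : i ∈ K
  · exact ⟨insert j K, mem_image_of_mem _ hj, mem_insert_of_mem hi⟩
  · exact ⟨insert i K, mem_image_of_mem _ (mem_compl.2 hi), mem_insert_self i K⟩

end Transitivity

theorem theorem3_general (N d : ℕ) (hd : 2 ≤ d) :
    (∀ S T : Finset (Fin N), S ∪ T = univ → SizeThreshold d N #S → SizeThreshold d N #T →
      ∀ᵐ ψ ∂(haarPureState N d),
        ExhibitsTransitivity {S, T} (fun Q => marginal Q (pureDensity ψ.1))
          (remainingLarge d {S, T})) ∧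
    (∀ (G : Finset (Finset (Fin N))) (K : Finset (Fin N)), G.Nonempty →
      (∀ S ∈ G, K ⊆ S ∧ SizeThreshold d N #S) → (∀ i, ∃ S ∈ G, i ∈ S) → N ≤ 2 * #K →
      ∀ᵐ ψ ∂(haarPureState N d),
        ExhibitsTransitivity G (fun Q => marginal Q (pureDensity ψ.1)) (remainingLarge d G)) := by
  refine ⟨fun S T hST hS hT => ?_, fun G K hG hKG hcover hK => ?_⟩
  · exact ae_exhibitsTransitivity_of_ae_isRigid hd (by simp [hS, hT]) (ae_isRigid_pair hd hST hS hT)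
  · refine ae_exhibitsTransitivity_of_ae_isRigid hd (fun S hS => (hKG S hS).2) ?_
    exact (ae_linearIndependent_coeffMatrix_col (by omega) hK).mono fun ψ hψ =>
      isRigid_of_subset hG (fun S hS => (hKG S hS).1) hcover hψ

theorem theorem3 (N d : ℕ) (hN : 3 ≤ N) (hd : 2 ≤ d) :
    ((3 ≤ d ∨ Even N) →
      ∀ S T : Finset (Fin N), S.card = N / 2 + 1 → T.card = N / 2 + 1 →
        (S ∩ T).card = (if Even N then 2 else 1) →
        ∀ᵐ ψ ∂(haarPureState N d),
          ExhibitsTransitivity {S, T} (fun Q => marginal Q (pureDensity ψ.1))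
            (remainingLarge d {S, T})) ∧
    (∀ K : Finset (Fin N), K.card = (N + 1) / 2 →
      ∀ᵐ ψ ∂(haarPureState N d),
        ExhibitsTransitivity (Kᶜ.image fun j => insert j K)
          (fun Q => marginal Q (pureDensity ψ.1))
          (remainingLarge d (Kᶜ.image fun j => insert j K))) := by
  refine ⟨fun h S T hS hT hST => ?_, fun K hK => ?_⟩
  · exact (theorem3_general N d hd).1 S T (union_eq_univ_of_card_inter hS hT hST)
      (hS ▸ sizeThreshold_half_add_one h) (hT ▸ sizeThreshold_half_add_one h)
  · have hK' : Kᶜ.Nonempty := card_pos.1 (by rw [card_compl, Fintype.card_fin]; omega)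
    have hstar : ∀ S ∈ Kᶜ.image fun j => insert j K, K ⊆ S ∧ SizeThreshold d N #S :=
      forall_mem_image.2 fun j hj =>
        ⟨subset_insert j K, sizeThreshold_card_insert (mem_compl.1 hj) (by omega)⟩
    exact (theorem3_general N d hd).2 _ K (hK'.image _) hstar
      (exists_mem_image_insert_compl hK') (by omega)
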